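/- A min-max Stackelberg game $(X,Y,f,g)$ consists of nonempty compact sets $X\subset\mathbb R^n$, $Y\subset\mathbb R^m$ and continuous functions $f,g_1,\dots,g_K:X\times Y\to\mathbb R$. Write $V(x)=\max_{y\in Y:\,g(x,y)\ge 0} f(x,y)$ and $V^\star=\min_{x\in X}V(x)$ (the Stackelberg value). For $\varepsilon,\delta\ge 0$, a pair $(x,y)\in X\times Y$ with $g(x,y)\ge 0$ is an $(\varepsilon,\delta)$-Stackelberg equilibrium if $V(x)-\delta\le f(x,y)\le V^\star+\varepsilon$. Assume that $X$ is convex and that: 1. (Slater) for every $x\in X$ there is $\hat y\in Y$ with $g_k(x,\hat y)>0$ for all $k$; 2. the gradients $\nabla_x f,\nabla_x g_1,\dots,\nabla_x g_K$ (relative to $X$) exist and are continuous on $X\times Y$; 3. $f$ is convex in $x$ and concave in $y$, and for every $k$ the function $\mu g_k(x,y)$ is convex in $(\mu,x)$ on $\mathbb R_+\times X$ for every $y\in Y$, and concave in $y$ for every $x\in X$ and $\mu\ge0$. Max-oracle gradient descent with accuracy $\delta\ge 0$ and step sizes $\eta_1,\eta_2,\dots$ starts at some $x^{(0)}\in X$.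 At each $x^{(t)}$ an oracle returns some $y^{(t)}\in Y$ with $g(x^{(t)},y^{(t)})\ge 0$ and $f(x^{(t)},y^{(t)})\ge V(x^{(t)})-\delta$; one takes some $\lambda^{(t)}\in\arg\min_{\lambda\in\mathbb R_+^K}\{f(x^{(t)},y^{(t)})+\sum_k\lambda_k g_k(x^{(t)},y^{(t)})\}$ and sets $$x^{(t+1)}=\Pi_X\Big(x^{(t)}-\eta_{t+1}\big[\nabla_x f(x^{(t)},y^{(t)})+\textstyle\sum_k\lambda^{(t)}_k\nabla_x g_k(x^{(t)},y^{(t)})\big]\Big),$$ where $\Pi_X$ is the Euclidean projection onto $X$. After $T$ iterations, $y^{(T)}$ is obtained by a last oracle call. For $t\ge1$, a best iterate at time $t$ is a pair $(x_{\rm best}^{(t)},y_{\rm best}^{(t)})\in\arg\min\{f(x^{(k)},y^{(k)}):1\le k\le t\}$. (i) If $\eta_t\ge0$, $\sum_{t\ge 1}\eta_t^2<\infty$ and $\sum_{t\ge 1}\eta_t=\infty$, then there is a $(0,\delta)$-Stackelberg equilibrium $(x^*,y^*)$, so that in particular $V^\star-\delta\le f(x^*,y^*)\le V^\star$, with $$\lim_{T\to\infty}f(x_{\rm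 best}^{(T)},y_{\rm best}^{(T)})=f(x^*,y^*).$$ If $\delta=0$, this holds for every $(0,0)$-Stackelberg equilibrium $(x^*,y^*)$, and the limit is $V^\star$. (ii) There are a constant $C$ and numbers $N(\varepsilon)\in\mathbb N$ with $N(\varepsilon)\le C\varepsilon^{-2}$ for $\varepsilon\in(0,1)$, depending only on the game, such that for all $\varepsilon\in(0,1)$, all $\delta\ge0$ and all $T\ge N(\varepsilon)$: if the algorithm is run for $T$ iterations with the constant step size $\eta_t=\|x^{(0)}-x^*\|/\sqrt T$, where $x^*$ is a minimizer of $V$ over $X$, then there is $T^*$ with $1\le T^*\le T$ such that every best iterate at time $T^*$ is an $(\varepsilon,\delta)$-Stackelberg equilibrium. -/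

import Mathlib

open Set Filter Topology

/-- A min-max Stackelberg game `(X, Y, f, g)`: nonempty compact strategy sets `X ⊆ ℝⁿ`, `Y ⊆ ℝᵐ`,
a continuous objective `f : X × Y → ℝ` and continuous constraints `g₁, …, g_K : X × Y → ℝ`.
Only the values of `f` and `g` on `X × Y` are ever used. -/
structure StackelbergGame (n m K : ℕ) where
  X : Set (EuclideanSpace ℝ (Fin n))
  Y : Set (EuclideanSpace ℝ (Fin m))
  f : EuclideanSpace ℝ (Fin n) → EuclideanSpace ℝ (Fin m) → ℝ
  g : Fin K → EuclideanSpace ℝ (Fin n) → EuclideanSpace ℝ (Fin m) → ℝ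
  X_nonempty : X.Nonempty
  X_compact : IsCompact X
  Y_nonempty : Y.Nonempty
  Y_compact : IsCompact Y
  f_continuous : ContinuousOn (Function.uncurry f) (X ×ˢ Y)
  g_continuous : ∀ k, ContinuousOn (Function.uncurry (g k)) (X ×ˢ Y)

namespace StackelbergGame

variable {n m K : ℕ} (G : StackelbergGame n m K)

/-- The inner player's feasible set `{y ∈ Y : g(x, y) ≥ 0}`. -/
def feasible (x : EuclideanSpace ℝ (Fin n)) : Set (EuclideanSpace ℝ (Fin m)) :=
  {y | y ∈ G.Y ∧ ∀ k, 0 ≤ G.g k x y}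

/-- The outer player's value function `V(x) = max {f(x, y) : y ∈ Y, g(x, y) ≥ 0}`
(the supremum is attained when `x ∈ X` and the feasible set is nonempty). -/
noncomputable def value (x : EuclideanSpace ℝ (Fin n)) : ℝ :=
  sSup (G.f x '' G.feasible x)

/-- The Stackelberg value `min_{x ∈ X} V(x)`. -/
noncomputable def stackelbergValue : ℝ :=
  sInf (G.value '' G.X)

/-- `(x, y)` is an `(ε, δ)`-Stackelberg equilibrium: it is feasible and
`V(x) - δ ≤ f(x, y) ≤ min V + ε`. -/
structure IsStackelbergEq (ε δ : ℝ) (x : EuclideanSpace ℝ (Fin n))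
    (y : EuclideanSpace ℝ (Fin m)) : Prop where
  mem_X : x ∈ G.X
  mem_feasible : y ∈ G.feasible x
  inner_le : G.value x - δ ≤ G.f x y
  outer_le : G.f x y ≤ G.stackelbergValue + ε

/-- Concavity of `h` on a set `S` which need not be convex: the concavity inequality holds
whenever the convex combination lies in `S`. For convex `S` this is `ConcaveOn ℝ S h`. -/
def ConcaveRel (S : Set (EuclideanSpace ℝ (Fin m))) (h : EuclideanSpace ℝ (Fin m) → ℝ) : Prop :=
  ∀ y₁ ∈ S, ∀ y₂ ∈ S, ∀ a b : ℝ, 0 ≤ a → 0 ≤ b → a + b = 1 → a • y₁ + b • y₂ ∈ S →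
    a * h y₁ + b * h y₂ ≤ h (a • y₁ + b • y₂)

theorem concaveRel_iff {S : Set (EuclideanSpace ℝ (Fin m))} (hS : Convex ℝ S)
    (h : EuclideanSpace ℝ (Fin m) → ℝ) : ConcaveRel S h ↔ ConcaveOn ℝ S h := by
  constructor
  · intro H
    refine ⟨hS, fun y₁ h₁ y₂ h₂ a b ha hb hab => ?_⟩
    simpa using H y₁ h₁ y₂ h₂ a b ha hb hab (hS h₁ h₂ ha hb hab)
  · intro H y₁ h₁ y₂ h₂ a b ha hb hab _
    simpa using H.2 h₁ h₂ ha hb hab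

/-- The standing assumptions, where `∇f x y` and `∇g k x y` are the gradients at `x`, relative to
`X`, of `f(·, y)` and of `g_k(·, y)`: Slater's condition; existence and continuity of the
`x`-gradients; `f` is convex in `x` and concave in `y`; `μ g_k(x, y)` is convex in `(μ, x)` on
`ℝ₊ × X` for every `y` and concave in `y` for every `(μ, x)`. -/
structure MainAssumption
    (gradf : EuclideanSpace ℝ (Fin n) → EuclideanSpace ℝ (Fin m) → EuclideanSpace ℝ (Fin n))
    (gradg : Fin K → EuclideanSpace ℝ (Fin n) → EuclideanSpace ℝ (Fin m) →
      EuclideanSpace ℝ (Fin n)) : Prop where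
  slater : ∀ x ∈ G.X, ∃ y ∈ G.Y, ∀ k, 0 < G.g k x y
  gradf_spec : ∀ x ∈ G.X, ∀ y ∈ G.Y,
    HasGradientWithinAt (fun z => G.f z y) (gradf x y) G.X x
  gradg_spec : ∀ k, ∀ x ∈ G.X, ∀ y ∈ G.Y,
    HasGradientWithinAt (fun z => G.g k z y) (gradg k x y) G.X x
  gradf_continuous : ContinuousOn (Function.uncurry gradf) (G.X ×ˢ G.Y)
  gradg_continuous : ∀ k, ContinuousOn (Function.uncurry (gradg k)) (G.X ×ˢ G.Y)
  f_convex : ∀ y ∈ G.Y, ConvexOn ℝ G.X (fun x => G.f x y)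
  f_concave : ∀ x ∈ G.X, ConcaveRel G.Y (G.f x)
  g_convex : ∀ k, ∀ y ∈ G.Y,
    ConvexOn ℝ (Ici (0 : ℝ) ×ˢ G.X)
      (fun p : ℝ × EuclideanSpace ℝ (Fin n) => p.1 * G.g k p.2 y)
  g_concave : ∀ k, ∀ μ : ℝ, 0 ≤ μ → ∀ x ∈ G.X, ConcaveRel G.Y (fun y => μ * G.g k x y)

/-- The Lagrangian `f(x, y) + ∑ₖ λₖ gₖ(x, y)`. -/
noncomputable def lagrangian (x : EuclideanSpace ℝ (Fin n)) (y : EuclideanSpace ℝ (Fin m))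
    (l : Fin K → ℝ) : ℝ :=
  G.f x y + ∑ k, l k * G.g k x y

/-- `l` is an optimal multiplier associated with `(x, y)`:
`l ∈ argmin_{λ ∈ ℝ₊ᴷ} {f(x, y) + ∑ₖ λₖ gₖ(x, y)}`. -/
def IsMultiplier (x : EuclideanSpace ℝ (Fin n)) (y : EuclideanSpace ℝ (Fin m))
    (l : Fin K → ℝ) : Prop :=
  0 ≤ l ∧ ∀ l' : Fin K → ℝ, 0 ≤ l' → G.lagrangian x y l ≤ G.lagrangian x y l'

/-- `y` is an admissible answer of a `δ`-max-oracle at `x`. -/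
def IsOracleAnswer (δ : ℝ) (x : EuclideanSpace ℝ (Fin n)) (y : EuclideanSpace ℝ (Fin m)) : Prop :=
  y ∈ G.feasible x ∧ G.value x - δ ≤ G.f x y

/-- `q` is a Euclidean projection of `p` onto `S`. -/
def IsProjection (S : Set (EuclideanSpace ℝ (Fin n))) (p q : EuclideanSpace ℝ (Fin n)) : Prop :=
  q ∈ S ∧ ∀ z ∈ S, dist p q ≤ dist p z

/-- The sequences `x`, `y`, `l` are produced by max-oracle gradient descent, run for `T` iterations
with step sizes `η 1, …, η T`, from `x 0 ∈ X`. Iteration `t + 1` turns `x t` into `x (t + 1)`; a last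
oracle call yields `y T`. -/
structure IsMOGDRun
    (gradf : EuclideanSpace ℝ (Fin n) → EuclideanSpace ℝ (Fin m) → EuclideanSpace ℝ (Fin n))
    (gradg : Fin K → EuclideanSpace ℝ (Fin n) → EuclideanSpace ℝ (Fin m) →
      EuclideanSpace ℝ (Fin n))
    (δ : ℝ) (η : ℕ → ℝ) (T : ℕ)
    (x : ℕ → EuclideanSpace ℝ (Fin n)) (y : ℕ → EuclideanSpace ℝ (Fin m))
    (l : ℕ → Fin K → ℝ) : Prop where
  init : x 0 ∈ G.X
  oracle : ∀ t ≤ T, G.IsOracleAnswer δ (x t) (y t)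
  multiplier : ∀ t < T, G.IsMultiplier (x t) (y t) (l t)
  step : ∀ t < T, IsProjection G.X
    (x t - η (t + 1) • (gradf (x t) (y t) + ∑ k, l t k • gradg k (x t) (y t))) (x (t + 1))

/-- `(u, v) ∈ argmin {f(x⁽ᵏ⁾, y⁽ᵏ⁾) : k = 1, …, t}` is a best iterate at time `t`. -/
def IsBestIterate (x : ℕ → EuclideanSpace ℝ (Fin n)) (y : ℕ → EuclideanSpace ℝ (Fin m)) (t : ℕ)
    (u : EuclideanSpace ℝ (Fin n)) (v : EuclideanSpace ℝ (Fin m)) : Prop :=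
  (∃ k, 1 ≤ k ∧ k ≤ t ∧ u = x k ∧ v = y k) ∧
    ∀ k, 1 ≤ k → k ≤ t → G.f u v ≤ G.f (x k) (y k)

end StackelbergGame

/-! Joint convexity of `μ g_k` in `(μ, x)` is so strong that `g_k` cannot depend on `x ∈ X`
(`g_eq`). Hence the feasible set is the same at every `x`, and `∑ λ_k ∇g_k` is orthogonal to `X`, so
the projection does not see it, whatever `λ` is. What remains is a projected subgradient method with
directions `∇f(x_t, y_t)`.

As `y_t` stays feasible against every `z ∈ X`, convexity of `f(·, y_t)` gives `f(x_t, y_t) - V(z) ≤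
⟨∇f(x_t, y_t), x_t - z⟩`. The usual expansion of `‖x_{t+1} - z‖²` then telescopes
(`sq_norm_sub_succ_le`, `sum_mul_le`). It bounds `f(x_t, y_t)` rather than `V(x_t)`, so `δ` does not
enter the outer inequality; the inner one is the oracle's guarantee.

For (i), values staying above some `V(z)` by a fixed amount contradict `∑ η = ∞`, `∑ η² < ∞`;
compactness supplies the equilibrium. For (ii), the constant step gives an error `O(1/√T)`. -/

/-! ### Convexity and projections -/

/-- First-order characterisation of convexity, for gradients relative to the set. -/
theorem ConvexOn.add_inner_le_of_hasGradientWithinAt {F : Type*} [NormedAddCommGroup F]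
    [InnerProductSpace ℝ F] [CompleteSpace F] {S : Set F} {h : F → ℝ} (hh : ConvexOn ℝ S h)
    {s x z : F} (hx : x ∈ S) (hz : z ∈ S) (hs : HasGradientWithinAt h s S x) :
    h x + inner ℝ s (z - x) ≤ h z := by
  have hmaps : MapsTo (AffineMap.lineMap (k := ℝ) x z) (Icc (0 : ℝ) 1) S := fun t ht =>
    hh.1.lineMap_mem hx hz ht
  have hd : HasDerivWithinAt (h ∘ AffineMap.lineMap (k := ℝ) x z) (inner ℝ s (z - x))
      (Icc (0 : ℝ) 1) 0 := by
    have h1 : HasFDerivWithinAt h (InnerProductSpace.toDual ℝ F s) S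
        (AffineMap.lineMap (k := ℝ) x z (0 : ℝ)) := by
      simpa using hs.hasFDerivWithinAt
    simpa using h1.comp_hasDerivWithinAt (0 : ℝ)
      (AffineMap.hasDerivWithinAt_lineMap (𝕜 := ℝ) (a := x) (b := z)) hmaps
  have hcv : ConvexOn ℝ (Icc (0 : ℝ) 1) (h ∘ AffineMap.lineMap (k := ℝ) x z) :=
    (hh.comp_affineMap (AffineMap.lineMap (k := ℝ) x z)).subset hmaps (convex_Icc 0 1)
  have := hcv.le_slope_of_hasDerivWithinAt (x := 0) (y := 1) (by simp) (by simp) one_pos hd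
  simp [slope_def_field] at this
  linarith

/-- A gradient of a constant function, relative to a convex set, is orthogonal to the set. -/
theorem inner_eq_zero_of_hasGradientWithinAt {F : Type*} [NormedAddCommGroup F]
    [InnerProductSpace ℝ F] [CompleteSpace F] {S : Set F} (hS : Convex ℝ S) {h : F → ℝ} {c : ℝ}
    (hc : ∀ x ∈ S, h x = c) {s x z : F} (hx : x ∈ S) (hz : z ∈ S)
    (hs : HasGradientWithinAt h s S x) : inner ℝ s (z - x) = 0 := by
  -- Both `h` and `-h` are convex, so the gradient inequality holds in both directions.
  have hcx : ConvexOn ℝ S h := (convexOn_const c hS).congr fun w hw => (hc w hw).symm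
  have hcx' : ConvexOn ℝ S (-h) := (convexOn_const (-c) hS).congr fun w hw => by simp [hc w hw]
  have h1 := hcx.add_inner_le_of_hasGradientWithinAt hx hz hs
  have hs' : HasGradientWithinAt (-h) (-s) S x := by
    rw [hasGradientWithinAt_iff_hasFDerivWithinAt] at hs ⊢
    simpa using hs.neg
  have h2 := hcx'.add_inner_le_of_hasGradientWithinAt hx hz hs'
  simp only [Pi.neg_apply, inner_neg_left, hc x hx, hc z hz] at h1 h2
  linarith

namespace StackelbergGame

/-- A projected step decreases squared distances to points of the set, also when the step direction
is perturbed by a vector orthogonal to the set. -/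
theorem IsProjection.sq_norm_sub_le {n : ℕ} {S : Set (EuclideanSpace ℝ (Fin n))} (hS : Convex ℝ S)
    {x q s w z : EuclideanSpace ℝ (Fin n)} {c : ℝ} (hz : z ∈ S)
    (hw : ∀ z ∈ S, inner ℝ w (z - x) = 0) (hq : IsProjection S (x - c • (s + w)) q) :
    ‖q - z‖ ^ 2 ≤ ‖x - z‖ ^ 2 - 2 * c * inner ℝ s (x - z) + c ^ 2 * ‖s‖ ^ 2 := by
  have hinf : ‖x - c • (s + w) - q‖ = ⨅ v : S, ‖x - c • (s + w) - v‖ := by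
    have : Nonempty S := ⟨⟨z, hz⟩⟩
    refine le_antisymm (le_ciInf fun v => ?_) ?_
    · simpa only [dist_eq_norm] using hq.2 v v.2
    · exact ciInf_le ⟨0, by rintro _ ⟨v, rfl⟩; exact norm_nonneg _⟩ (⟨q, hq.1⟩ : S)
  have hvar := (norm_eq_iInf_iff_real_inner_le_zero hS hq.1).1 hinf z hz
  -- Since `z - q = (z - x) - (q - x)`, the perturbation drops out of the variational inequality for
  -- `q`.
  have hwz : inner ℝ w (z - q) = 0 := by
    rw [← sub_sub_sub_cancel_right z q x, inner_sub_right, hw z hz, hw q hq.1, sub_zero]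
  have h1 : inner ℝ (x - c • s - q) (z - q) ≤ 0 := by
    have : x - c • (s + w) - q = (x - c • s - q) - c • w := by module
    rw [this, inner_sub_left, inner_smul_left, hwz] at hvar
    simpa using hvar
  have h2 : ‖x - c • s - z‖ ^ 2 = ‖x - c • s - q‖ ^ 2 - 2 * inner ℝ (x - c • s - q) (z - q)
      + ‖z - q‖ ^ 2 := by
    rw [← norm_sub_sq_real, sub_sub_sub_cancel_right]
  have h3 : ‖x - c • s - z‖ ^ 2 =
      ‖x - z‖ ^ 2 - 2 * c * inner ℝ s (x - z) + c ^ 2 * ‖s‖ ^ 2 := by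
    rw [sub_right_comm, norm_sub_sq_real, inner_smul_right, real_inner_comm, norm_smul, mul_pow,
      Real.norm_eq_abs, sq_abs]
    ring
  rw [← h3, h2, norm_sub_rev q z]
  nlinarith [sq_nonneg ‖x - c • s - q‖]

variable {n m K : ℕ} {G : StackelbergGame n m K}
  {gradf : EuclideanSpace ℝ (Fin n) → EuclideanSpace ℝ (Fin m) → EuclideanSpace ℝ (Fin n)}
  {gradg : Fin K → EuclideanSpace ℝ (Fin n) → EuclideanSpace ℝ (Fin m) →
    EuclideanSpace ℝ (Fin n)}

theorem bddAbove_f_feasible {x : EuclideanSpace ℝ (Fin n)} (hx : x ∈ G.X) :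
    BddAbove (G.f x '' G.feasible x) := by
  have hc : ContinuousOn (G.f x) G.Y :=
    G.f_continuous.comp (f := fun y => (x, y)) (by fun_prop) fun y hy => ⟨hx, hy⟩
  exact (G.Y_compact.bddAbove_image hc).mono (image_mono fun y hy => hy.1)

theorem f_le_value {x : EuclideanSpace ℝ (Fin n)} (hx : x ∈ G.X) {y : EuclideanSpace ℝ (Fin m)}
    (hy : y ∈ G.feasible x) : G.f x y ≤ G.value x :=
  le_csSup (bddAbove_f_feasible hx) ⟨y, hy, rfl⟩

/-! ### Consequences of the assumptions: constraints independent of `x` -/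

namespace MainAssumption

/-- Joint convexity of `μ g_k(x, y)` in `(μ, x)` forces `g_k` to be independent of `x`. -/
theorem g_eq (hG : G.MainAssumption gradf gradg) (k : Fin K) {x z : EuclideanSpace ℝ (Fin n)}
    (hx : x ∈ G.X) (hz : z ∈ G.X) {y : EuclideanSpace ℝ (Fin m)} (hy : y ∈ G.Y) :
    G.g k x y = G.g k z y := by
  have hX : Convex ℝ G.X := by
    intro a ha b hb s t hs ht hst
    exact ((hG.g_convex k y hy).1 (x := (0, a)) ⟨by simp, ha⟩ (y := (0, b)) ⟨by simp, hb⟩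
      hs ht hst).2
  have key : ∀ x ∈ G.X, ∀ z ∈ G.X, G.g k x y ≤ G.g k z y := by
    intro x hx z hz
    have hc : ContinuousOn (fun t : ℝ => G.g k (AffineMap.lineMap x z t) y) (Icc 0 1) :=
      (G.g_continuous k).comp (f := fun t : ℝ => (AffineMap.lineMap x z t, y))
        (by fun_prop) fun t ht => ⟨hX.lineMap_mem hx hz ht, hy⟩
    have ht : Tendsto (fun t : ℝ => G.g k (AffineMap.lineMap x z t) y) (𝓝[>] 0)
        (𝓝 (G.g k x y)) := by
      have := (hc 0 (by simp)).mono_left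
        (nhdsWithin_le_iff.2 (Icc_mem_nhdsGT (zero_lt_one' ℝ)))
      simpa [ContinuousWithinAt] using this
    refine le_of_tendsto ht ?_
    filter_upwards [Ioo_mem_nhdsGT (zero_lt_one' ℝ)] with t ht
    -- Weights `1 - t`, `t` on `(0, x)`, `(1, z)` give `t * g(x + t(z - x)) ≤ t * g(z)`; cancel `t`,
    -- then let `t → 0`.
    have := (hG.g_convex k y hy).2 (x := (0, x)) ⟨by simp, hx⟩ (y := (1, z)) ⟨by simp, hz⟩
      (sub_nonneg.2 ht.2.le) ht.1.le (by ring)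
    simp only [Prod.smul_mk, Prod.mk_add_mk, smul_eq_mul, mul_zero, mul_one, zero_add, zero_mul,
      one_mul] at this
    rw [AffineMap.lineMap_apply_module]
    exact le_of_mul_le_mul_left this ht.1
  exact le_antisymm (key x hx z hz) (key z hz x hx)

theorem feasible_eq (hG : G.MainAssumption gradf gradg) {x z : EuclideanSpace ℝ (Fin n)}
    (hx : x ∈ G.X) (hz : z ∈ G.X) : G.feasible x = G.feasible z := by
  ext y
  refine and_congr_right fun hy => forall_congr' fun k => ?_
  rw [hG.g_eq k hx hz hy]

/-- Slater points are feasible, so `value` is a genuine supremum on `X`. -/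
theorem f_image_nonempty (hG : G.MainAssumption gradf gradg) {x : EuclideanSpace ℝ (Fin n)}
    (hx : x ∈ G.X) : (G.f x '' G.feasible x).Nonempty :=
  let ⟨y, hy, h⟩ := hG.slater x hx
  ⟨_, y, ⟨hy, fun k => (h k).le⟩, rfl⟩

theorem stackelbergValue_le (hG : G.MainAssumption gradf gradg) {x : EuclideanSpace ℝ (Fin n)}
    (hx : x ∈ G.X) : G.stackelbergValue ≤ G.value x := by
  refine csInf_le ?_ ⟨x, hx, rfl⟩
  obtain ⟨b, hb⟩ := (G.X_compact.prod G.Y_compact).bddBelow_image G.f_continuous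
  refine ⟨b, ?_⟩
  rintro _ ⟨z, hz, rfl⟩
  obtain ⟨_, y, hy, rfl⟩ := hG.f_image_nonempty hz
  exact (hb ⟨(z, y), ⟨hz, hy.1⟩, rfl⟩).trans (f_le_value hz hy)

theorem exists_norm_gradf_le (hG : G.MainAssumption gradf gradg) :
    ∃ L : ℝ, 0 ≤ L ∧ ∀ x ∈ G.X, ∀ y ∈ G.Y, ‖gradf x y‖ ≤ L := by
  obtain ⟨L, hL⟩ := (G.X_compact.prod G.Y_compact).exists_bound_of_continuousOn
    hG.gradf_continuous
  exact ⟨max L 0, le_max_right _ _, fun x hx y hy => (hL (x, y) ⟨hx, hy⟩).trans (le_max_left _ _)⟩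

/-- The multiplier part of the step direction is orthogonal to `X`. -/
theorem inner_sum_smul_gradg_eq_zero (hG : G.MainAssumption gradf gradg) (hX : Convex ℝ G.X)
    {x z : EuclideanSpace ℝ (Fin n)} (hx : x ∈ G.X) (hz : z ∈ G.X)
    {y : EuclideanSpace ℝ (Fin m)} (hy : y ∈ G.Y) (l : Fin K → ℝ) :
    inner ℝ (∑ k, l k • gradg k x y) (z - x) = 0 := by
  rw [sum_inner]
  refine Finset.sum_eq_zero fun k _ => ?_
  rw [inner_smul_left, inner_eq_zero_of_hasGradientWithinAt hX
    (fun w hw => hG.g_eq k hw hx hy) hx hz (hG.gradg_spec k _ hx _ hy), mul_zero]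

end MainAssumption

/-! ### Descent inequalities -/

namespace IsMOGDRun

variable {δ : ℝ} {η : ℕ → ℝ} {T : ℕ} {x : ℕ → EuclideanSpace ℝ (Fin n)}
  {y : ℕ → EuclideanSpace ℝ (Fin m)} {l : ℕ → Fin K → ℝ}

theorem mem_X (hr : G.IsMOGDRun gradf gradg δ η T x y l) : ∀ t ≤ T, x t ∈ G.X
  | 0, _ => hr.init
  | t + 1, ht => (hr.step t ht).1

/-- One step of max-oracle gradient descent, compared with an arbitrary point of `X`. -/
theorem sq_norm_sub_succ_le (hr : G.IsMOGDRun gradf gradg δ η T x y l) (hX : Convex ℝ G.X)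
    (hG : G.MainAssumption gradf gradg) {L : ℝ}
    (hL : ∀ x ∈ G.X, ∀ y ∈ G.Y, ‖gradf x y‖ ≤ L) {t : ℕ} (ht : t < T) (hη : 0 ≤ η (t + 1))
    {z : EuclideanSpace ℝ (Fin n)} (hz : z ∈ G.X) :
    ‖x (t + 1) - z‖ ^ 2 ≤
      ‖x t - z‖ ^ 2 - 2 * η (t + 1) * (G.f (x t) (y t) - G.value z) + η (t + 1) ^ 2 * L ^ 2 := by
  have hxt := hr.mem_X t ht.le
  have hyt := (hr.oracle t ht.le).1
  have h1 := (hr.step t ht).sq_norm_sub_le hX hz fun w hw =>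
    hG.inner_sum_smul_gradg_eq_zero hX hxt hw hyt.1 _
  have h2 := (hG.f_convex _ hyt.1).add_inner_le_of_hasGradientWithinAt hxt hz
    (hG.gradf_spec _ hxt _ hyt.1)
  have h3 : G.f z (y t) ≤ G.value z := f_le_value hz (hG.feasible_eq hxt hz ▸ hyt)
  have h4 : inner ℝ (gradf (x t) (y t)) (z - x t) = -inner ℝ (gradf (x t) (y t)) (x t - z) := by
    rw [← inner_neg_right, neg_sub]
  have h5 : ‖gradf (x t) (y t)‖ ^ 2 ≤ L ^ 2 := by
    gcongr
    exact hL _ hxt _ hyt.1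
  have h6 := mul_le_mul_of_nonneg_left h5 (sq_nonneg (η (t + 1)))
  have h7 : η (t + 1) * (G.f (x t) (y t) - G.value z) ≤
      η (t + 1) * inner ℝ (gradf (x t) (y t)) (x t - z) :=
    mul_le_mul_of_nonneg_left (by linarith) hη
  linarith

/-- The summed descent inequality, from the first to the last iterate. -/
theorem sum_mul_le (hX : Convex ℝ G.X)
    (hG : G.MainAssumption gradf gradg) {L : ℝ}
    (hL : ∀ x ∈ G.X, ∀ y ∈ G.Y, ‖gradf x y‖ ≤ L) (hη : ∀ t, 0 ≤ η t)
    {z : EuclideanSpace ℝ (Fin n)} (hz : z ∈ G.X) {c : ℝ} (N : ℕ)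
    (hr : G.IsMOGDRun gradf gradg δ η (N + 1) x y l)
    (hc : ∀ t, 1 ≤ t → t ≤ N + 1 → c ≤ G.f (x t) (y t) - G.value z) :
    2 * c * ∑ t ∈ Finset.range N, η (t + 2) ≤
      ‖x 1 - z‖ ^ 2 + L ^ 2 * ∑ t ∈ Finset.range N, η (t + 2) ^ 2 := by
  -- Best iterates exclude `x 0`, so the telescoping starts at `x 1`, whose outgoing step is `η 2`.
  suffices h : ∀ j ≤ N, ‖x (j + 1) - z‖ ^ 2 + 2 * c * ∑ t ∈ Finset.range j, η (t + 2) ≤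
      ‖x 1 - z‖ ^ 2 + L ^ 2 * ∑ t ∈ Finset.range j, η (t + 2) ^ 2 by
    have := h N le_rfl
    linarith [sq_nonneg ‖x (N + 1) - z‖]
  intro j
  induction j with
  | zero => simp
  | succ j ih =>
    intro hj
    have h1 := ih (by omega)
    have h2 := hr.sq_norm_sub_succ_le hX hG hL (t := j + 1) (by omega) (hη _) hz
    have h3 := mul_le_mul_of_nonneg_left (hc (j + 1) (by omega) (by omega)) (hη (j + 2))
    rw [Finset.sum_range_succ, Finset.sum_range_succ]
    simp only [add_assoc, one_add_one_eq_two] at h2 ⊢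
    nlinarith

end IsMOGDRun

/-- A best iterate is an admissible oracle answer at a point of `X`. -/
theorem IsBestIterate.isOracleAnswer {δ : ℝ} {η : ℕ → ℝ} {T t : ℕ}
    {x : ℕ → EuclideanSpace ℝ (Fin n)} {y : ℕ → EuclideanSpace ℝ (Fin m)} {l : ℕ → Fin K → ℝ}
    (hr : G.IsMOGDRun gradf gradg δ η T x y l) (ht : t ≤ T) {u : EuclideanSpace ℝ (Fin n)}
    {v : EuclideanSpace ℝ (Fin m)} (h : G.IsBestIterate x y t u v) :
    u ∈ G.X ∧ G.IsOracleAnswer δ u v := by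
  obtain ⟨⟨k, -, hk, rfl, rfl⟩, -⟩ := h
  exact ⟨hr.mem_X k (hk.trans ht), hr.oracle k (hk.trans ht)⟩

/-! ### Convergence for square-summable steps -/

section Convergence

variable {δ : ℝ} {η : ℕ → ℝ} {x : ℕ → EuclideanSpace ℝ (Fin n)}
  {y : ℕ → EuclideanSpace ℝ (Fin m)} {l : ℕ → Fin K → ℝ}
  {u : ℕ → EuclideanSpace ℝ (Fin n)} {v : ℕ → EuclideanSpace ℝ (Fin m)}

/-- With square-summable, non-summable steps, the objective values at the iterates cannot stay above
the Stackelberg value. -/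
theorem le_stackelbergValue_of_forall_le (hX : Convex ℝ G.X) (hG : G.MainAssumption gradf gradg)
    (hη : ∀ t, 0 ≤ η t) (hsq : Summable fun t => η t ^ 2)
    (hsum : Tendsto (fun T : ℕ => ∑ t ∈ Finset.Icc 1 T, η t) atTop atTop)
    (hr : ∀ T, G.IsMOGDRun gradf gradg δ η T x y l) {p : ℝ}
    (hp : ∀ t, 1 ≤ t → p ≤ G.f (x t) (y t)) : p ≤ G.stackelbergValue := by
  obtain ⟨L, -, hL⟩ := hG.exists_norm_gradf_le
  refine le_csInf (G.X_nonempty.image _) ?_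
  rintro _ ⟨z, hz, rfl⟩
  by_contra! hlt
  have hsum' : Tendsto (fun N : ℕ => ∑ t ∈ Finset.range N, η (t + 2)) atTop atTop := by
    have h := tendsto_atTop_add_const_right _ (-η 1) (hsum.comp (tendsto_add_atTop_nat 1))
    refine h.congr fun N => ?_
    simp only [Function.comp_apply]
    rw [Finset.range_eq_Ico, Finset.sum_Ico_add' η 0 N 2,
      ← Finset.Ico_succ_right_eq_Icc, Finset.sum_eq_sum_Ico_succ_bot (by simp)]
    simp [add_assoc]
  -- With a positive gap the left side of `sum_mul_le` diverges while its right side stays bounded.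
  have hpos : 0 < 2 * (p - G.value z) := by linarith
  obtain ⟨N, hN⟩ := ((tendsto_atTop.1 (hsum'.const_mul_atTop hpos))
    (‖x 1 - z‖ ^ 2 + L ^ 2 * ∑' t, η t ^ 2 + 1)).exists
  have h1 := IsMOGDRun.sum_mul_le hX hG hL hη hz (c := p - G.value z) N (hr (N + 1))
    fun t ht _ => sub_le_sub_right (hp t ht) _
  have h2 : ∑ t ∈ Finset.range N, η (t + 2) ^ 2 ≤ ∑' t, η t ^ 2 := by
    rw [Finset.range_eq_Ico, Finset.sum_Ico_add' (fun t => η t ^ 2) 0 N 2]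
    exact hsq.sum_le_tsum _ fun t _ => sq_nonneg _
  have h3 := mul_le_mul_of_nonneg_left h2 (sq_nonneg L)
  linarith

/-- The best objective values converge, to a limit attained at a `(0, δ)`-equilibrium. -/
theorem exists_isStackelbergEq_tendsto (hX : Convex ℝ G.X) (hG : G.MainAssumption gradf gradg)
    (hη : ∀ t, 0 ≤ η t) (hsq : Summable fun t => η t ^ 2)
    (hsum : Tendsto (fun T : ℕ => ∑ t ∈ Finset.Icc 1 T, η t) atTop atTop)
    (hr : ∀ T, G.IsMOGDRun gradf gradg δ η T x y l)
    (hb : ∀ t, 1 ≤ t → G.IsBestIterate x y t (u t) (v t)) :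
    ∃ xs ys, G.IsStackelbergEq 0 δ xs ys ∧
      Tendsto (fun T => G.f (u T) (v T)) atTop (𝓝 (G.f xs ys)) := by
  -- The shift avoids `u 0` and `v 0`, which are arbitrary.
  have hor : ∀ t, u (t + 1) ∈ G.X ∧ G.IsOracleAnswer δ (u (t + 1)) (v (t + 1)) := fun t =>
    (hb (t + 1) (by omega)).isOracleAnswer (hr (t + 1)) le_rfl
  have hanti : Antitone fun t => G.f (u (t + 1)) (v (t + 1)) := by
    refine antitone_nat_of_succ_le fun t => ?_
    obtain ⟨⟨k, hk1, hk, hu, hv⟩, -⟩ := hb (t + 1) (by omega)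
    rw [hu, hv]
    exact (hb (t + 1 + 1) (by omega)).2 k hk1 (by omega)
  have hbdd : BddBelow (range fun t => G.f (u (t + 1)) (v (t + 1))) := by
    refine ⟨G.stackelbergValue - δ, ?_⟩
    rintro _ ⟨t, rfl⟩
    have h1 := (hor t).2.2
    have h2 := hG.stackelbergValue_le (hor t).1
    dsimp only
    linarith
  have hlim := tendsto_atTop_ciInf hanti hbdd
  set p := ⨅ t, G.f (u (t + 1)) (v (t + 1))
  have hple : p ≤ G.stackelbergValue := by
    refine le_stackelbergValue_of_forall_le hX hG hη hsq hsum hr fun t ht => ?_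
    obtain ⟨s, rfl⟩ := Nat.exists_eq_add_of_le' ht
    exact (ciInf_le hbdd s).trans ((hb (s + 1) ht).2 _ ht le_rfl)
  obtain ⟨⟨xs, ys⟩, ⟨hxs, hys⟩, φ, hφ, hconv⟩ := (G.X_compact.prod G.Y_compact).tendsto_subseq
    (x := fun t => (u (t + 1), v (t + 1))) fun t => ⟨(hor t).1, (hor t).2.1.1⟩
  have hwithin : Tendsto (fun t => (u (φ t + 1), v (φ t + 1))) atTop
      (𝓝[G.X ×ˢ G.Y] (xs, ys)) :=
    tendsto_nhdsWithin_iff.2 ⟨hconv, .of_forall fun t => ⟨(hor _).1, (hor _).2.1.1⟩⟩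
  have hf : G.f xs ys = p :=
    tendsto_nhds_unique ((G.f_continuous (xs, ys) ⟨hxs, hys⟩).tendsto.comp hwithin)
      (hlim.comp hφ.tendsto_atTop)
  have hfeas : ys ∈ G.feasible xs := by
    refine ⟨hys, fun k => ?_⟩
    exact ge_of_tendsto ((G.g_continuous k (xs, ys) ⟨hxs, hys⟩).tendsto.comp hwithin)
      (.of_forall fun t => (hor _).2.1.2 k)
  -- Each `w` feasible at `xs` is feasible along the whole subsequence, so the oracle inequality
  -- passes to the limit for fixed `w`.
  have hinner : G.value xs - δ ≤ p := by
    rw [sub_le_iff_le_add]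
    refine csSup_le (hG.f_image_nonempty hxs) ?_
    rintro _ ⟨w, hw, rfl⟩
    have hwu : Tendsto (fun t => (u (φ t + 1), w)) atTop (𝓝[G.X ×ˢ G.Y] (xs, w)) :=
      tendsto_nhdsWithin_iff.2 ⟨((continuous_fst.tendsto _).comp hconv).prodMk_nhds
        tendsto_const_nhds, .of_forall fun t => ⟨(hor _).1, hw.1⟩⟩
    refine le_of_tendsto_of_tendsto' ((G.f_continuous (xs, w) ⟨hxs, hw.1⟩).tendsto.comp hwu)
      ((hlim.comp hφ.tendsto_atTop).add_const δ) fun t => ?_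
    have h1 := (hor (φ t)).2.2
    have h2 : G.f (u (φ t + 1)) w ≤ G.value (u (φ t + 1)) :=
      f_le_value (hor _).1 (hG.feasible_eq hxs (hor _).1 ▸ hw)
    simp only [Function.comp_apply, Function.uncurry_apply_pair]
    linarith
  refine ⟨xs, ys, ⟨hxs, hfeas, hf ▸ hinner, by rw [hf, add_zero]; exact hple⟩, ?_⟩
  rw [hf]
  exact (tendsto_add_atTop_iff_nat 1).1 hlim

end Convergence

/-! ### Iteration complexity for the constant step -/

/-- After `T ≥ 2` iterations with step size `‖x 0 - xs‖ / √T`, some iterate is within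
`2 ‖x 0 - xs‖ (1 + L)² / √T` of the value at `xs`. -/
theorem IsMOGDRun.exists_f_le {δ L : ℝ} {N : ℕ} {x : ℕ → EuclideanSpace ℝ (Fin n)}
    {y : ℕ → EuclideanSpace ℝ (Fin m)} {l : ℕ → Fin K → ℝ} {xs : EuclideanSpace ℝ (Fin n)}
    (hX : Convex ℝ G.X) (hG : G.MainAssumption gradf gradg) (hL0 : 0 ≤ L)
    (hL : ∀ x ∈ G.X, ∀ y ∈ G.Y, ‖gradf x y‖ ≤ L) (hxs : xs ∈ G.X) (hN : 1 ≤ N)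
    (hr : G.IsMOGDRun gradf gradg δ (fun _ => ‖x 0 - xs‖ / √((N + 1 : ℕ) : ℝ)) (N + 1) x y l) :
    ∃ k, 1 ≤ k ∧ k ≤ N + 1 ∧
      G.f (x k) (y k) ≤ G.value xs + 2 * ‖x 0 - xs‖ * (1 + L) ^ 2 / √((N + 1 : ℕ) : ℝ) := by
  set D := ‖x 0 - xs‖ with hD
  set R := √((N + 1 : ℕ) : ℝ) with hR
  have hD0 : 0 ≤ D := norm_nonneg _
  have hRsq : R ^ 2 = N + 1 := by rw [hR, Real.sq_sqrt (by positivity)]; push_cast; ring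
  have hN' : (1 : ℝ) ≤ N := by exact_mod_cast hN
  have hR1 : 1 ≤ R := by rw [hR, Real.one_le_sqrt]; push_cast; linarith
  -- The first step may move away from `xs`; Cauchy–Schwarz limits the loss to the step length.
  have hx1 : ‖x 1 - xs‖ ≤ D + D / R * L := by
    have hy := (hr.oracle 0 (by omega)).1.1
    have hp := (hr.step 0 (by omega)).sq_norm_sub_le hX hxs fun w hw =>
      hG.inner_sum_smul_gradg_eq_zero hX hr.init hw hy _
    have hs := hL _ hr.init _ hy
    have hi := (abs_le.1 (abs_real_inner_le_norm (gradf (x 0) (y 0)) (x 0 - xs))).1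
    have hη : 0 ≤ D / R := by positivity
    rw [← hD] at hp hi
    refine (pow_le_pow_iff_left₀ (norm_nonneg _) (by positivity) two_ne_zero).1 ?_
    have hi' : -(L * D) ≤ inner ℝ (gradf (x 0) (y 0)) (x 0 - xs) :=
      (neg_le_neg (mul_le_mul_of_nonneg_right hs hD0)).trans hi
    have h1 := mul_le_mul_of_nonneg_left hi' hη
    have h2 : (D / R) ^ 2 * ‖gradf (x 0) (y 0)‖ ^ 2 ≤ (D / R) ^ 2 * L ^ 2 := by gcongr
    simp only [zero_add] at hp
    linarith
  -- If `D = 0` the step size vanishes and `x 1 = xs`; otherwise `D² / R²` can be cancelled.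
  rcases hD0.eq_or_lt with hD00 | hDpos
  · refine ⟨1, le_rfl, by omega, ?_⟩
    rw [← hD00] at hx1
    have : x 1 = xs := by
      simpa [sub_eq_zero] using le_antisymm (hx1.trans (by simp)) (norm_nonneg (x 1 - xs))
    rw [this, ← hD00]
    simpa using f_le_value hxs (this ▸ (hr.oracle 1 (by omega)).1)
  by_contra! hlt
  have hs := IsMOGDRun.sum_mul_le hX hG hL (fun _ => by positivity) hxs
    (c := 2 * D * (1 + L) ^ 2 / R) N hr fun t h1 h2 => by linarith [hlt t h1 h2]
  simp only [Finset.sum_const, Finset.card_range, nsmul_eq_mul] at hs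
  have hsq : ‖x 1 - xs‖ ^ 2 ≤ (D + D / R * L) ^ 2 := by gcongr
  have hR0 : 0 < R := by linarith
  have hN2 : (N : ℝ) = R ^ 2 - 1 := by linarith
  have h1 : 2 * (2 * D * (1 + L) ^ 2 / R) * (N * (D / R)) =
      D ^ 2 / R ^ 2 * (4 * (1 + L) ^ 2 * (R ^ 2 - 1)) := by
    rw [hN2]
    field_simp
    ring
  have h2 : (D + D / R * L) ^ 2 + L ^ 2 * (N * (D / R) ^ 2) =
      D ^ 2 / R ^ 2 * ((R + L) ^ 2 + L ^ 2 * (R ^ 2 - 1)) := by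
    rw [hN2]
    field_simp
  have h3 := le_of_mul_le_mul_left
    (h1.symm.le.trans ((hs.trans (add_le_add_left hsq _)).trans h2.le)) (by positivity)
  -- Here `R² ≥ 2`: the left side of `h3` is at least `2(1 + L)²R²`, its right side at most `(1 +
  -- L)²R²`.
  have h4 : (1 + L) ^ 2 * R ^ 2 ≤ (1 + L) ^ 2 * (2 * (R ^ 2 - 1)) := by
    gcongr
    linarith
  have h5 : L * R ≤ L * R ^ 2 := by
    gcongr
    nlinarith
  nlinarith [mul_nonneg (sq_nonneg L) (sq_nonneg R), mul_nonneg hL0 (sq_nonneg R), sq_nonneg L]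

/-- The `O(ε⁻²)` iteration bound for the step size `‖x 0 - xs‖ / √T`. -/
theorem exists_iteration_bound (hX : Convex ℝ G.X) (hG : G.MainAssumption gradf gradg) :
    ∃ N : ℝ → ℕ, (∃ C : ℝ, ∀ ε ∈ Ioo (0 : ℝ) 1, (N ε : ℝ) ≤ C * (ε ^ 2)⁻¹) ∧
      ∀ ε ∈ Ioo (0 : ℝ) 1, ∀ δ : ℝ, ∀ T : ℕ, N ε ≤ T →
      ∀ (x : ℕ → EuclideanSpace ℝ (Fin n)) (y : ℕ → EuclideanSpace ℝ (Fin m))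
        (l : ℕ → Fin K → ℝ),
      ∀ xs ∈ G.X, (∀ z ∈ G.X, G.value xs ≤ G.value z) →
        G.IsMOGDRun gradf gradg δ (fun _ => ‖x 0 - xs‖ / √(T : ℝ)) T x y l →
      1 ≤ T ∧ ∀ u v, G.IsBestIterate x y T u v → G.IsStackelbergEq ε δ u v := by
  obtain ⟨L, hL0, hL⟩ := hG.exists_norm_gradf_le
  set A := 2 * Metric.diam G.X * (1 + L) ^ 2 with hA
  -- The `+ 2` forces `T ≥ 2`, as `exists_f_le` needs; with the rounding it costs `3 ≤ 3ε⁻²`.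
  refine ⟨fun ε => ⌈(A / ε) ^ 2⌉₊ + 2, ⟨A ^ 2 + 3, fun ε hε => ?_⟩, ?_⟩
  · have h1 := (Nat.ceil_lt_add_one (sq_nonneg (A / ε))).le
    have h2 : 1 ≤ (ε ^ 2)⁻¹ :=
      (one_le_inv₀ (pow_pos hε.1 2)).2 (pow_le_one₀ hε.1.le hε.2.le)
    rw [div_pow, div_eq_mul_inv] at h1
    dsimp only
    rw [div_pow, div_eq_mul_inv]
    push_cast
    linarith
  · intro ε hε δ T hT x y l xs hxs hmin hr
    dsimp only at hT
    obtain ⟨N, rfl⟩ : ∃ N, T = N + 1 := ⟨T - 1, by omega⟩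
    refine ⟨by omega, fun u v hb => ?_⟩
    obtain ⟨k, hk1, hk, hf⟩ := hr.exists_f_le hX hG hL0 hL hxs (by omega)
    obtain ⟨huX, hu⟩ := hb.isOracleAnswer hr le_rfl
    refine ⟨huX, hu.1, hu.2, ((hb.2 k hk1 hk).trans hf).trans (add_le_add ?_ ?_)⟩
    · refine le_csInf (G.X_nonempty.image _) ?_
      rintro _ ⟨z, hz, rfl⟩
      exact hmin z hz
    · have hle : A / ε ≤ √((N + 1 : ℕ) : ℝ) := by
        refine Real.le_sqrt_of_sq_le ((Nat.le_ceil _).trans ?_)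
        exact_mod_cast (by omega : ⌈(A / ε) ^ 2⌉₊ ≤ N + 1)
      have hD : ‖x 0 - xs‖ ≤ Metric.diam G.X := by
        rw [← dist_eq_norm]
        exact Metric.dist_le_diam_of_mem G.X_compact.isBounded hr.init hxs
      rw [div_le_iff₀ (by positivity), mul_comm ε]
      calc 2 * ‖x 0 - xs‖ * (1 + L) ^ 2 ≤ A := by rw [hA]; gcongr
        _ ≤ _ := (div_le_iff₀ hε.1).1 hle

/-- The objective value at a `(0, 0)`-equilibrium is the Stackelberg value. -/
theorem IsStackelbergEq.f_eq (hG : G.MainAssumption gradf gradg) {x : EuclideanSpace ℝ (Fin n)}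
    {y : EuclideanSpace ℝ (Fin m)} (h : G.IsStackelbergEq 0 0 x y) :
    G.f x y = G.stackelbergValue := by
  have h1 := h.inner_le
  have h2 := h.outer_le
  have h3 := hG.stackelbergValue_le h.mem_X
  linarith

end StackelbergGame

theorem mainTheorem2 {n m K : ℕ} (G : StackelbergGame n m K) (hX : Convex ℝ G.X)
    (gradf : EuclideanSpace ℝ (Fin n) → EuclideanSpace ℝ (Fin m) → EuclideanSpace ℝ (Fin n))
    (gradg : Fin K → EuclideanSpace ℝ (Fin n) → EuclideanSpace ℝ (Fin m) →
      EuclideanSpace ℝ (Fin n))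
    (hG : G.MainAssumption gradf gradg) :
    -- convergence for square-summable, non-summable step sizes
    (∀ (δ : ℝ) (η : ℕ → ℝ), 0 ≤ δ → (∀ t, 0 ≤ η t) → Summable (fun t => η t ^ 2) →
      Tendsto (fun T : ℕ => ∑ t ∈ Finset.Icc 1 T, η t) atTop atTop →
      ∀ (x : ℕ → EuclideanSpace ℝ (Fin n)) (y : ℕ → EuclideanSpace ℝ (Fin m))
        (l : ℕ → Fin K → ℝ), (∀ T, G.IsMOGDRun gradf gradg δ η T x y l) →
      ∀ (u : ℕ → EuclideanSpace ℝ (Fin n)) (v : ℕ → EuclideanSpace ℝ (Fin m)),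
        (∀ t, 1 ≤ t → G.IsBestIterate x y t (u t) (v t)) →
      (∃ xs ys, G.IsStackelbergEq 0 δ xs ys ∧
        G.stackelbergValue - δ ≤ G.f xs ys ∧ G.f xs ys ≤ G.stackelbergValue ∧
        Tendsto (fun T => G.f (u T) (v T)) atTop (𝓝 (G.f xs ys))) ∧
      (δ = 0 → ∀ xs ys, G.IsStackelbergEq 0 0 xs ys →
        Tendsto (fun T => G.f (u T) (v T)) atTop (𝓝 (G.f xs ys)))) ∧
    -- iteration complexity `O(ε⁻²)` with step size `‖x⁽⁰⁾ - x*‖ / √T`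
    (∃ N : ℝ → ℕ, (∃ C : ℝ, ∀ ε ∈ Ioo (0 : ℝ) 1, (N ε : ℝ) ≤ C * (ε ^ 2)⁻¹) ∧
      ∀ ε ∈ Ioo (0 : ℝ) 1, ∀ δ : ℝ, 0 ≤ δ → ∀ T : ℕ, N ε ≤ T →
      ∀ (x : ℕ → EuclideanSpace ℝ (Fin n)) (y : ℕ → EuclideanSpace ℝ (Fin m))
        (l : ℕ → Fin K → ℝ),
      ∀ xs ∈ G.X, (∀ z ∈ G.X, G.value xs ≤ G.value z) →
        G.IsMOGDRun gradf gradg δ (fun _ => ‖x 0 - xs‖ / √(T : ℝ)) T x y l →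
      ∃ Ts : ℕ, 1 ≤ Ts ∧ Ts ≤ T ∧
        ∀ u v, G.IsBestIterate x y Ts u v → G.IsStackelbergEq ε δ u v) := by
  refine ⟨fun δ η _ hη hsq hsum x y l hr u v hb => ?_, ?_⟩
  · obtain ⟨xs, ys, heq, hlim⟩ :=
      StackelbergGame.exists_isStackelbergEq_tendsto hX hG hη hsq hsum hr hb
    refine ⟨⟨xs, ys, heq, ?_, ?_, hlim⟩, ?_⟩
    · have h1 := hG.stackelbergValue_le heq.mem_X
      have h2 := heq.inner_le
      linarith
    · simpa using heq.outer_le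
    · rintro rfl xs' ys' heq'
      rwa [heq'.f_eq hG, ← heq.f_eq hG]
  · obtain ⟨N, hC, hN⟩ := StackelbergGame.exists_iteration_bound hX hG
    refine ⟨N, hC, fun ε hε δ _ T hT x y l xs hxs hmin hr => ?_⟩
    obtain ⟨h1, h2⟩ := hN ε hε δ T hT x y l xs hxs hmin hr
    exact ⟨T, h1, le_rfl, h2⟩
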